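/- Let $n\ge 1$ and, for $1\le q\le p<\infty$ and measurable $f:\mathbb R^n\to\mathbb C$ (modulo equality a.e.), put $$m(f,p,q;r)=\sup_{x\in\mathbb R^n}|B(x,r)|^{1/p}\Bigl(\frac1{|B(x,r)|}\int_{B(x,r)}|f(y)|^q\,dy\Bigr)^{1/q}\quad(r>0),\qquad \|f\|_{\mathcal M^p_q}=\sup_{r>0}m(f,p,q;r).$$ Let $\mathcal M^p_q=\{f:\|f\|_{\mathcal M^p_q}<\infty\}$ be the Morrey space, with closed subspaces $V_0\mathcal M^p_q=\{f\in\mathcal M^p_q:\lim_{r\to0^+}m(f,p,q;r)=0\}$, $V_\infty\mathcal M^p_q=\{f\in\mathcal M^p_q:\lim_{r\to\infty}m(f,p,q;r)=0\}$ and $$V^{(*)}\mathcal M^p_q=\Bigl\{f\in\mathcal M^p_q:\lim_{N\to\infty}\sup_{x\in\mathbb R^n}\int_{B(x,1)}|f(y)|^q\chi_{\mathbb R^n\setminus B(0,N)}(y)\,dy=0\Bigr\}.$$ For Banach spaces $X_0,X_1$ of measurable functions (modulo equality a.e.) with the norms above, let $[X_0,X_1]_\theta$ be Calderón's first complex interpolation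 space: the set of all $F(\theta)$, where $F$ is a bounded continuous function from $\{z\in\mathbb C:0\le\mathrm{Re}\,z\le1\}$ to $X_0+X_1$, holomorphic in $\{0<\mathrm{Re}\,z<1\}$, such that for $k=0,1$ the map $t\mapsto F(k+it)$ is a bounded continuous function from $\mathbb R$ to $X_k$. Let $\theta\in(0,1)$, $1\le q_0<p_0<\infty$, $1\le q_1<p_1<\infty$, $\frac{p_0}{q_0}=\frac{p_1}{q_1}$, and define $p,q$ by $\frac1p=\frac{1-\theta}{p_0}+\frac\theta{p_1}$, $\frac1q=\frac{1-\theta}{q_0}+\frac\theta{q_1}$. Let $R>2$ solve $R^{\frac np-\frac nq}2^{\frac nq}=1$, and let $$E(p,q)=\Bigl\{y+(R-1)\sum_{j=1}^\infty R^{j-1}a_j\;:\;y\in[0,1]^n,\ a_j\in\{0,1\}^n\text{ for all }j,\ a_j=0\text{ for all but finitely many }j\Bigr\},$$ a union of closed unit cubes. Then $f_1=\chi_{E(p,q)}$ satisfies $$f_1\in[V_0\mathcal M^{p_0}_{q_0},V_0\mathcal M^{p_1}_{q_1}]_\theta,\qquad f_1\notin[V^{(*)}\mathcal M^{p_0}_{q_0},V^{(*)}\mathcal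 M^{p_1}_{q_1}]_\theta\cup[V_\infty\mathcal M^{p_0}_{q_0},V_\infty\mathcal M^{p_1}_{q_1}]_\theta.$$ Moreover $f_1\in\mathcal M^p_q$, $f_1\notin V^{(*)}\mathcal M^p_q$ and $f_1\notin V_\infty\mathcal M^p_q$. -/

import Mathlib

open MeasureTheory Filter Topology Set
open scoped ENNReal NNReal

noncomputable section

namespace VanishingMorrey

/-! ### The first complex interpolation method -/

section Interpolation

variable {Z X₀ X₁ : Type*} [AddCommGroup Z] [Module ℂ Z]
  [NormedAddCommGroup X₀] [NormedSpace ℂ X₀] [NormedAddCommGroup X₁] [NormedSpace ℂ X₁]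

/-- The sum `X₀ + X₁` of two normed spaces that lie in a common vector space `Z` through the
embeddings `ι₀`, `ι₁`: the quotient of `X₀ × X₁` by the pairs with `ι₀ x₀ + ι₁ x₁ = 0`.
The quotient norm is `inf max(‖x₀‖, ‖x₁‖)` over the decompositions `f = x₀ + x₁`; it is
equivalent to (between half and once) the norm `inf (‖x₀‖ + ‖x₁‖)`, so that it
gives the same bounded, continuous and holomorphic functions. -/
abbrev SumSpace (ι₀ : X₀ →ₗ[ℂ] Z) (ι₁ : X₁ →ₗ[ℂ] Z) : Type _ :=
  (X₀ × X₁) ⧸ LinearMap.ker (ι₀.coprod ι₁)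

/-- The inclusion `X₀ + X₁ → Z`. -/
def SumSpace.incl (ι₀ : X₀ →ₗ[ℂ] Z) (ι₁ : X₁ →ₗ[ℂ] Z) : SumSpace ι₀ ι₁ →ₗ[ℂ] Z :=
  (LinearMap.ker (ι₀.coprod ι₁)).liftQ (ι₀.coprod ι₁) le_rfl

/-- The inclusion `X₀ → X₀ + X₁`. -/
def SumSpace.inl (ι₀ : X₀ →ₗ[ℂ] Z) (ι₁ : X₁ →ₗ[ℂ] Z) : X₀ →ₗ[ℂ] SumSpace ι₀ ι₁ :=
  (LinearMap.ker (ι₀.coprod ι₁)).mkQ ∘ₗ LinearMap.inl ℂ X₀ X₁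

/-- The inclusion `X₁ → X₀ + X₁`. -/
def SumSpace.inr (ι₀ : X₀ →ₗ[ℂ] Z) (ι₁ : X₁ →ₗ[ℂ] Z) : X₁ →ₗ[ℂ] SumSpace ι₀ ι₁ :=
  (LinearMap.ker (ι₀.coprod ι₁)).mkQ ∘ₗ LinearMap.inr ℂ X₀ X₁

/-- The open strip `0 < Re z < 1`. -/
def openStrip : Set ℂ := {z | 0 < z.re ∧ z.re < 1}

/-- The closed strip `0 ≤ Re z ≤ 1`. -/
def closedStrip : Set ℂ := {z | 0 ≤ z.re ∧ z.re ≤ 1}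

/-- `F` belongs to Calderón's space `𝓕(X₀, X₁)`: it is bounded and continuous from the closed strip
to `X₀ + X₁`, holomorphic in the open strip, and `t ↦ F (k + i t)` is a bounded continuous function
from `ℝ` to `X_k` for `k = 0, 1`. -/
structure IsCalderonFunction (ι₀ : X₀ →ₗ[ℂ] Z) (ι₁ : X₁ →ₗ[ℂ] Z) (F : ℂ → SumSpace ι₀ ι₁) :
    Prop where
  continuousOn : ContinuousOn F closedStrip
  bounded : ∃ C : ℝ, ∀ z ∈ closedStrip, ‖F z‖ ≤ C
  differentiableOn : DifferentiableOn ℂ F openStrip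
  boundary_zero : ∃ g : ℝ → X₀, Continuous g ∧ (∃ C : ℝ, ∀ t, ‖g t‖ ≤ C) ∧
    ∀ t : ℝ, F (t * Complex.I) = SumSpace.inl ι₀ ι₁ (g t)
  boundary_one : ∃ g : ℝ → X₁, Continuous g ∧ (∃ C : ℝ, ∀ t, ‖g t‖ ≤ C) ∧
    ∀ t : ℝ, F (1 + t * Complex.I) = SumSpace.inr ι₀ ι₁ (g t)

/-- The first complex interpolation space `[X₀, X₁]_θ`, as a subset of `Z`. -/
def complexInterpolation (ι₀ : X₀ →ₗ[ℂ] Z) (ι₁ : X₁ →ₗ[ℂ] Z) (θ : ℝ) : Set Z :=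
  {f | ∃ F : ℂ → SumSpace ι₀ ι₁, IsCalderonFunction ι₀ ι₁ F ∧ SumSpace.incl ι₀ ι₁ (F θ) = f}

end Interpolation

/-! ### Morrey spaces -/

/-- Measurable functions `ℝⁿ → ℂ` modulo almost everywhere equality. -/
abbrev MeasFun (n : ℕ) : Type := EuclideanSpace ℝ (Fin n) →ₘ[volume] ℂ

/-- `m(f, p, q; r)`, the supremum over `x` of
`|B(x,r)|^(1/p) (|B(x,r)|⁻¹ ∫_{B(x,r)} |f|^q)^(1/q)`, with values in `[0, ∞]`. -/
def morreyMod {n : ℕ} (p q : ℝ) (f : MeasFun n) (r : ℝ) : ℝ≥0∞ :=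
  ⨆ x : EuclideanSpace ℝ (Fin n), volume (Metric.ball x r) ^ (1 / p) *
    ((volume (Metric.ball x r))⁻¹ * ∫⁻ y in Metric.ball x r, ‖f y‖ₑ ^ q) ^ (1 / q)

/-- The Morrey norm, with values in `[0, ∞]`. -/
def morreyENorm {n : ℕ} (p q : ℝ) (f : MeasFun n) : ℝ≥0∞ :=
  ⨆ r : ℝ, ⨆ _ : 0 < r, morreyMod p q f r

/-- `sup_x ∫_{B(x,1)} |f|^q χ_{ℝⁿ ∖ B(0,N)}`. -/
def outerMod {n : ℕ} (q : ℝ) (f : MeasFun n) (N : ℕ) : ℝ≥0∞ :=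
  ⨆ x : EuclideanSpace ℝ (Fin n), ∫⁻ y in Metric.ball x 1,
    (Metric.ball (0 : EuclideanSpace ℝ (Fin n)) N)ᶜ.indicator (fun y => ‖f y‖ₑ ^ q) y

/-- `f` is in the Morrey space `𝓜^p_q(ℝⁿ)`. -/
def MemMorrey {n : ℕ} (p q : ℝ) (f : MeasFun n) : Prop := morreyENorm p q f < ∞

/-- `f` is in `V_0 𝓜^p_q`, the vanishing Morrey space at the origin. -/
def MemVZero {n : ℕ} (p q : ℝ) (f : MeasFun n) : Prop :=
  MemMorrey p q f ∧ Tendsto (morreyMod p q f) (𝓝[>] 0) (𝓝 0)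

/-- `f` is in `V_∞ 𝓜^p_q`, the vanishing Morrey space at infinity. -/
def MemVInfty {n : ℕ} (p q : ℝ) (f : MeasFun n) : Prop :=
  MemMorrey p q f ∧ Tendsto (morreyMod p q f) atTop (𝓝 0)

/-- `f` is in `V^(*) 𝓜^p_q`. -/
def MemVStar {n : ℕ} (p q : ℝ) (f : MeasFun n) : Prop :=
  MemMorrey p q f ∧ Tendsto (outerMod q f) atTop (𝓝 0)

section Laws

variable {n : ℕ} {p q : ℝ}

lemma morreyMod_zero (hq : 1 ≤ q) (r : ℝ) : morreyMod p q (0 : MeasFun n) r = 0 := by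
  have hq0 : 0 < q := by linarith
  simp only [morreyMod, ENNReal.iSup_eq_zero]
  intro x
  have : ∫⁻ y in Metric.ball x r, ‖(0 : MeasFun n) y‖ₑ ^ q = 0 := by
    refine lintegral_eq_zero_of_ae_eq_zero ?_
    filter_upwards [ae_restrict_of_ae (AEEqFun.coeFn_zero (μ := volume)
      (α := EuclideanSpace ℝ (Fin n)) (β := ℂ))] with y hy
    rw [hy]; simp [hq0]
  rw [this]; simp [hq0]

lemma morreyMod_add_le (hq : 1 ≤ q) (f g : MeasFun n) (r : ℝ) :
    morreyMod p q (f + g) r ≤ morreyMod p q f r + morreyMod p q g r := by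
  have hq0 : 0 < q := by linarith
  refine iSup_le fun x => ?_
  refine le_trans ?_ (add_le_add (le_iSup _ x) (le_iSup _ x))
  rw [← mul_add]
  refine mul_le_mul_right ?_ _
  simp only [ENNReal.mul_rpow_of_nonneg _ _ (one_div_nonneg.2 hq0.le), ← mul_add]
  refine mul_le_mul_right ?_ _
  refine le_trans ?_ (ENNReal.lintegral_Lp_add_le (μ := volume.restrict (Metric.ball x r))
    (f := fun y => ‖f y‖ₑ) (g := fun y => ‖g y‖ₑ)
    f.aestronglyMeasurable.enorm.restrict g.aestronglyMeasurable.enorm.restrict hq)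
  refine ENNReal.rpow_le_rpow ?_ (by positivity)
  refine lintegral_mono_ae ?_
  filter_upwards [ae_restrict_of_ae (AEEqFun.coeFn_add f g)] with y hy
  rw [hy]
  exact ENNReal.rpow_le_rpow (enorm_add_le _ _) hq0.le

lemma morreyMod_smul (hq : 1 ≤ q) (c : ℂ) (f : MeasFun n) (r : ℝ) :
    morreyMod p q (c • f) r = ‖c‖ₑ * morreyMod p q f r := by
  have hq0 : 0 < q := by linarith
  simp only [morreyMod, ENNReal.mul_iSup]
  refine iSup_congr fun x => ?_
  have : ∫⁻ y in Metric.ball x r, ‖(c • f) y‖ₑ ^ q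
      = ‖c‖ₑ ^ q * ∫⁻ y in Metric.ball x r, ‖f y‖ₑ ^ q := by
    rw [← lintegral_const_mul' _ _ (by simp [hq0.le])]
    refine lintegral_congr_ae ?_
    filter_upwards [ae_restrict_of_ae (AEEqFun.coeFn_smul c f)] with y hy
    rw [hy, Pi.smul_apply, enorm_smul, ENNReal.mul_rpow_of_nonneg _ _ hq0.le]
  rw [this]
  simp only [ENNReal.mul_rpow_of_nonneg _ _ (one_div_nonneg.2 hq0.le)]
  rw [← ENNReal.rpow_mul, mul_one_div_cancel hq0.ne', ENNReal.rpow_one]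
  ring

lemma morreyENorm_zero (hq : 1 ≤ q) : morreyENorm p q (0 : MeasFun n) = 0 := by
  simp [morreyENorm, morreyMod_zero hq]

lemma morreyENorm_add_le (hq : 1 ≤ q) (f g : MeasFun n) :
    morreyENorm p q (f + g) ≤ morreyENorm p q f + morreyENorm p q g := by
  refine iSup₂_le fun r hr => (morreyMod_add_le hq f g r).trans ?_
  exact add_le_add (le_iSup₂ (f := fun r (_ : 0 < r) => morreyMod p q f r) r hr)
    (le_iSup₂ (f := fun r (_ : 0 < r) => morreyMod p q g r) r hr)

lemma morreyENorm_smul (hq : 1 ≤ q) (c : ℂ) (f : MeasFun n) :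
    morreyENorm p q (c • f) = ‖c‖ₑ * morreyENorm p q f := by
  simp only [morreyENorm, morreyMod_smul hq, ENNReal.mul_iSup]

lemma eq_zero_of_morreyENorm_eq_zero (hq : 1 ≤ q) {f : MeasFun n}
    (hf : morreyENorm p q f = 0) : f = 0 := by
  have hq0 : 0 < q := by linarith
  have key : ∀ k : ℕ, ∀ᵐ y ∂(volume.restrict
      (Metric.ball (0 : EuclideanSpace ℝ (Fin n)) ((k : ℝ) + 1))), f y = 0 := by
    intro k
    have hk : (0 : ℝ) < (k : ℝ) + 1 := by positivity
    simp only [morreyENorm, ENNReal.iSup_eq_zero, morreyMod] at hf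
    have h := hf _ hk 0
    have hpos : volume (Metric.ball (0 : EuclideanSpace ℝ (Fin n)) ((k : ℝ) + 1)) ≠ 0 :=
      (Metric.measure_ball_pos _ _ hk).ne'
    have hfin : volume (Metric.ball (0 : EuclideanSpace ℝ (Fin n)) ((k : ℝ) + 1)) ≠ ∞ :=
      measure_ball_lt_top.ne
    rcases mul_eq_zero.1 h with h | h
    · exact absurd h (ENNReal.rpow_pos (pos_iff_ne_zero.2 hpos) hfin).ne'
    · rw [ENNReal.rpow_eq_zero_iff_of_pos (by positivity)] at h
      rcases mul_eq_zero.1 h with h | h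
      · exact absurd h (ENNReal.inv_ne_zero.2 hfin)
      · rw [lintegral_eq_zero_iff' (by fun_prop)] at h
        filter_upwards [h] with y hy
        simpa [ENNReal.rpow_eq_zero_iff_of_pos hq0] using hy
  have hall : ∀ᵐ y ∂(volume : Measure (EuclideanSpace ℝ (Fin n))), f y = 0 := by
    have h := (ae_restrict_iUnion_iff _ _).2 key
    rwa [Metric.iUnion_ball_nat_succ, Measure.restrict_univ] at h
  refine AEEqFun.ext ?_
  filter_upwards [hall, AEEqFun.coeFn_zero (μ := volume)
    (α := EuclideanSpace ℝ (Fin n)) (β := ℂ)] with y h1 h2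
  rw [h1, h2]; rfl

lemma memMorrey_zero (hq : 1 ≤ q) : MemMorrey p q (0 : MeasFun n) := by
  simp [MemMorrey, morreyENorm_zero hq]

lemma MemMorrey.add (hq : 1 ≤ q) {f g : MeasFun n} (hf : MemMorrey p q f)
    (hg : MemMorrey p q g) : MemMorrey p q (f + g) :=
  (morreyENorm_add_le hq f g).trans_lt (ENNReal.add_lt_top.2 ⟨hf, hg⟩)

lemma MemMorrey.smul (hq : 1 ≤ q) (c : ℂ) {f : MeasFun n} (hf : MemMorrey p q f) :
    MemMorrey p q (c • f) := by
  rw [MemMorrey, morreyENorm_smul hq]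
  exact ENNReal.mul_lt_top enorm_lt_top hf

lemma tendsto_morreyMod_add (hq : 1 ≤ q) {l : Filter ℝ} {f g : MeasFun n}
    (hf : Tendsto (morreyMod p q f) l (𝓝 0)) (hg : Tendsto (morreyMod p q g) l (𝓝 0)) :
    Tendsto (morreyMod p q (f + g)) l (𝓝 0) :=
  tendsto_of_tendsto_of_tendsto_of_le_of_le tendsto_const_nhds (by simpa using hf.add hg)
    (fun _ => zero_le) (fun r => morreyMod_add_le hq f g r)

lemma tendsto_morreyMod_smul (hq : 1 ≤ q) {l : Filter ℝ} (c : ℂ) {f : MeasFun n}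
    (hf : Tendsto (morreyMod p q f) l (𝓝 0)) :
    Tendsto (morreyMod p q (c • f)) l (𝓝 0) := by
  have h := ENNReal.Tendsto.const_mul (a := ‖c‖ₑ) hf (Or.inr enorm_ne_top)
  rw [mul_zero] at h
  exact h.congr fun r => (morreyMod_smul hq c f r).symm

lemma tendsto_morreyMod_zero (hq : 1 ≤ q) (l : Filter ℝ) :
    Tendsto (morreyMod p q (0 : MeasFun n)) l (𝓝 0) :=
  tendsto_const_nhds.congr fun r => (morreyMod_zero hq r).symm

lemma outerMod_zero (hq : 1 ≤ q) (N : ℕ) : outerMod q (0 : MeasFun n) N = 0 := by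
  have hq0 : 0 < q := by linarith
  simp only [outerMod, ENNReal.iSup_eq_zero]
  intro x
  refine lintegral_eq_zero_of_ae_eq_zero ?_
  filter_upwards [ae_restrict_of_ae (AEEqFun.coeFn_zero (μ := volume)
    (α := EuclideanSpace ℝ (Fin n)) (β := ℂ))] with y hy
  simp only [Set.indicator, hy]
  simp [hq0]

lemma outerMod_add_le (hq : 1 ≤ q) (f g : MeasFun n) (N : ℕ) :
    outerMod q (f + g) N ≤ 2 ^ (q - 1) * (outerMod q f N + outerMod q g N) := by
  have hq0 : 0 < q := by linarith
  refine iSup_le fun x => ?_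
  refine le_trans ?_ (mul_le_mul_right (add_le_add (le_iSup _ x) (le_iSup _ x)) _)
  have hm : AEMeasurable ((Metric.ball (0 : EuclideanSpace ℝ (Fin n)) N)ᶜ.indicator
      (fun y => ‖f y‖ₑ ^ q)) (volume.restrict (Metric.ball x 1)) :=
    AEMeasurable.indicator (by fun_prop) Metric.isOpen_ball.measurableSet.compl
  rw [← lintegral_add_left' hm, ← lintegral_const_mul' _ _
    (ENNReal.rpow_ne_top_of_nonneg (by linarith) (by simp))]
  refine lintegral_mono_ae ?_
  filter_upwards [ae_restrict_of_ae (AEEqFun.coeFn_add f g)] with y hy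
  simp only [Set.indicator]
  split_ifs with h
  · rw [hy]
    exact (ENNReal.rpow_le_rpow (enorm_add_le _ _) hq0.le).trans
      (ENNReal.rpow_add_le_mul_rpow_add_rpow _ _ hq)
  · simp

lemma outerMod_smul (hq : 1 ≤ q) (c : ℂ) (f : MeasFun n) (N : ℕ) :
    outerMod q (c • f) N = ‖c‖ₑ ^ q * outerMod q f N := by
  have hq0 : 0 < q := by linarith
  simp only [outerMod, ENNReal.mul_iSup]
  refine iSup_congr fun x => ?_
  rw [← lintegral_const_mul' _ _ (by simp [hq0.le])]
  refine lintegral_congr_ae ?_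
  filter_upwards [ae_restrict_of_ae (AEEqFun.coeFn_smul c f)] with y hy
  simp only [Set.indicator]
  split_ifs
  · rw [hy, Pi.smul_apply, enorm_smul, ENNReal.mul_rpow_of_nonneg _ _ hq0.le]
  · simp

end Laws

/-- The Morrey space as a linear subspace of the space of measurable functions. -/
def morreySubmodule (n : ℕ) (p q : ℝ) (hq : 1 ≤ q) : Submodule ℂ (MeasFun n) where
  carrier := {f | MemMorrey p q f}
  zero_mem' := memMorrey_zero hq
  add_mem' hf hg := MemMorrey.add hq hf hg
  smul_mem' c _ hf := MemMorrey.smul hq c hf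

/-- The Morrey space `𝓜^p_q(ℝⁿ)`. -/
def Morrey (n : ℕ) (p q : ℝ) (hq : 1 ≤ q) : Type := ↥(morreySubmodule n p q hq)

section Instances

variable (n : ℕ) (p q : ℝ) (hq : 1 ≤ q)

instance : AddCommGroup (Morrey n p q hq) :=
  inferInstanceAs (AddCommGroup ↥(morreySubmodule n p q hq))

instance : Module ℂ (Morrey n p q hq) :=
  inferInstanceAs (Module ℂ ↥(morreySubmodule n p q hq))

/-- The inclusion of the Morrey space in the space of measurable functions. -/
def Morrey.incl : Morrey n p q hq →ₗ[ℂ] MeasFun n := (morreySubmodule n p q hq).subtype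

instance : Norm (Morrey n p q hq) where
  norm f := (morreyENorm p q (Morrey.incl n p q hq f)).toReal

lemma Morrey.memMorrey (f : Morrey n p q hq) : MemMorrey p q (Morrey.incl n p q hq f) := f.2

lemma Morrey.normCore : NormedSpace.Core ℂ (Morrey n p q hq) where
  norm_nonneg _ := ENNReal.toReal_nonneg
  norm_smul c f := by
    change (morreyENorm p q (Morrey.incl n p q hq (c • f))).toReal
      = ‖c‖ * (morreyENorm p q (Morrey.incl n p q hq f)).toReal
    rw [map_smul, morreyENorm_smul hq, ENNReal.toReal_mul, toReal_enorm]
  norm_triangle f g := by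
    change (morreyENorm p q (Morrey.incl n p q hq (f + g))).toReal
      ≤ (morreyENorm p q (Morrey.incl n p q hq f)).toReal
        + (morreyENorm p q (Morrey.incl n p q hq g)).toReal
    have hf : morreyENorm p q (Morrey.incl n p q hq f) ≠ ∞ := f.2.ne
    have hg : morreyENorm p q (Morrey.incl n p q hq g) ≠ ∞ := g.2.ne
    rw [map_add, ← ENNReal.toReal_add hf hg]
    exact ENNReal.toReal_mono (ENNReal.add_ne_top.2 ⟨hf, hg⟩) (morreyENorm_add_le hq _ _)
  norm_eq_zero_iff f := by
    change (morreyENorm p q (Morrey.incl n p q hq f)).toReal = 0 ↔ f = 0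
    have hf : morreyENorm p q (Morrey.incl n p q hq f) ≠ ∞ := f.2.ne
    rw [ENNReal.toReal_eq_zero_iff, or_iff_left hf]
    constructor
    · intro h
      exact Subtype.ext (eq_zero_of_morreyENorm_eq_zero hq h)
    · rintro rfl
      rw [map_zero, morreyENorm_zero hq]

instance : NormedAddCommGroup (Morrey n p q hq) :=
  NormedAddCommGroup.ofCore (Morrey.normCore n p q hq)

instance : NormedSpace ℂ (Morrey n p q hq) :=
  NormedSpace.ofCore (Morrey.normCore n p q hq)

/-- `V_0 𝓜^p_q`, with the norm of `𝓜^p_q`. -/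
def VZero : Submodule ℂ (Morrey n p q hq) where
  carrier := {f | MemVZero p q (Morrey.incl n p q hq f)}
  zero_mem' := by
    refine ⟨Morrey.memMorrey n p q hq 0, ?_⟩
    rw [map_zero]
    exact tendsto_morreyMod_zero hq _
  add_mem' {f g} hf hg := by
    refine ⟨Morrey.memMorrey n p q hq (f + g), ?_⟩
    rw [map_add]
    exact tendsto_morreyMod_add hq hf.2 hg.2
  smul_mem' c f hf := by
    refine ⟨Morrey.memMorrey n p q hq (c • f), ?_⟩
    rw [map_smul]
    exact tendsto_morreyMod_smul hq c hf.2

/-- `V_∞ 𝓜^p_q`, with the norm of `𝓜^p_q`. -/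
def VInfty : Submodule ℂ (Morrey n p q hq) where
  carrier := {f | MemVInfty p q (Morrey.incl n p q hq f)}
  zero_mem' := by
    refine ⟨Morrey.memMorrey n p q hq 0, ?_⟩
    rw [map_zero]
    exact tendsto_morreyMod_zero hq _
  add_mem' {f g} hf hg := by
    refine ⟨Morrey.memMorrey n p q hq (f + g), ?_⟩
    rw [map_add]
    exact tendsto_morreyMod_add hq hf.2 hg.2
  smul_mem' c f hf := by
    refine ⟨Morrey.memMorrey n p q hq (c • f), ?_⟩
    rw [map_smul]
    exact tendsto_morreyMod_smul hq c hf.2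

/-- `V^(*) 𝓜^p_q`, with the norm of `𝓜^p_q`. -/
def VStar : Submodule ℂ (Morrey n p q hq) where
  carrier := {f | MemVStar p q (Morrey.incl n p q hq f)}
  zero_mem' := by
    refine ⟨Morrey.memMorrey n p q hq 0, ?_⟩
    rw [map_zero]
    exact tendsto_const_nhds.congr fun N => (outerMod_zero hq N).symm
  add_mem' {f g} hf hg := by
    refine ⟨Morrey.memMorrey n p q hq (f + g), ?_⟩
    rw [map_add]
    have h := ENNReal.Tendsto.const_mul (a := (2 : ℝ≥0∞) ^ (q - 1)) (hf.2.add hg.2)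
      (Or.inr (ENNReal.rpow_ne_top_of_nonneg (by linarith) (by simp)))
    rw [add_zero, mul_zero] at h
    exact tendsto_of_tendsto_of_tendsto_of_le_of_le tendsto_const_nhds h
      (fun _ => zero_le) (fun N => outerMod_add_le hq _ _ N)
  smul_mem' c f hf := by
    refine ⟨Morrey.memMorrey n p q hq (c • f), ?_⟩
    rw [map_smul]
    have h := ENNReal.Tendsto.const_mul (a := ‖c‖ₑ ^ q) hf.2
      (Or.inr (ENNReal.rpow_ne_top_of_nonneg (by linarith) enorm_ne_top))
    rw [mul_zero] at h
    exact h.congr fun N => (outerMod_smul hq c _ N).symm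

/-- The inclusion of a subspace of the Morrey space in the space of measurable functions. -/
def subIncl {n : ℕ} {p q : ℝ} {hq : 1 ≤ q} (V : Submodule ℂ (Morrey n p q hq)) :
    V →ₗ[ℂ] MeasFun n :=
  Morrey.incl n p q hq ∘ₗ V.subtype

end Instances

/-- `[X₀, X₁]_θ` for subspaces `X₀`, `X₁` of two Morrey spaces, as a set of measurable functions. -/
def morreyInterpolation {n : ℕ} {p₀ q₀ p₁ q₁ : ℝ} {hq₀ : 1 ≤ q₀} {hq₁ : 1 ≤ q₁}
    (X₀ : Submodule ℂ (Morrey n p₀ q₀ hq₀)) (X₁ : Submodule ℂ (Morrey n p₁ q₁ hq₁)) (θ : ℝ) :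
    Set (MeasFun n) :=
  complexInterpolation (subIncl X₀) (subIncl X₁) θ

/-! ### The fractal-type set -/

/-- The set of the points with coordinates `y_k + (R - 1) (a_{1,k} + R a_{2,k} + R² a_{3,k} + ⋯)`,
where `y ∈ [0,1]ⁿ` and, for each `k`, `(a_{j,k})_j` is a summable (that is, finitely supported)
sequence of zeros and ones; `A k` is the finite set of all `j` with `a_{j+1,k} = 1`. -/
def fractalSet (n : ℕ) (R : ℝ) : Set (EuclideanSpace ℝ (Fin n)) :=
  {x | ∃ (A : Fin n → Finset ℕ) (y : Fin n → ℝ), (∀ k, y k ∈ Set.Icc (0 : ℝ) 1) ∧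
    ∀ k, x k = y k + (R - 1) * ∑ j ∈ A k, R ^ j}

lemma measurableSet_fractalSet (n : ℕ) (R : ℝ) : MeasurableSet (fractalSet n R) := by
  have : fractalSet n R = ⋃ A : Fin n → Finset ℕ, ⋂ k : Fin n,
      {x | x k - (R - 1) * ∑ j ∈ A k, R ^ j ∈ Set.Icc (0 : ℝ) 1} := by
    ext x
    simp only [fractalSet, Set.mem_ofPred_eq, Set.mem_iUnion, Set.mem_iInter]
    constructor
    · rintro ⟨A, y, hy, hx⟩
      exact ⟨A, fun k => by rw [hx k]; simpa using hy k⟩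
    · rintro ⟨A, hA⟩
      exact ⟨A, fun k => x k - (R - 1) * ∑ j ∈ A k, R ^ j, hA, fun k => by ring⟩
  rw [this]
  refine MeasurableSet.iUnion fun A => MeasurableSet.iInter fun k => ?_
  have hm : Measurable fun x : EuclideanSpace ℝ (Fin n) =>
      x k - (R - 1) * ∑ j ∈ A k, R ^ j := by fun_prop
  exact hm measurableSet_Icc

/-- The indicator function of `fractalSet n R`, as a measurable function on `ℝⁿ`. -/
def fractalIndicator (n : ℕ) (R : ℝ) : MeasFun n :=
  AEEqFun.mk ((fractalSet n R).indicator fun _ => (1 : ℂ))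
    ((stronglyMeasurable_const.indicator (measurableSet_fractalSet n R)).aestronglyMeasurable)

end VanishingMorrey

end

/-!
Write `E` for the fractal-type set, `f` for its indicator function and `s = 1 - q / p`. The equation
for `R` says `R ^ s = 2`. Since `q / p = q₀ / p₀ = q₁ / p₁`, it is the same equation for all three
pairs of exponents, so that each statement below holds for `(p, q)`, `(p₀, q₀)` and `(p₁, q₁)` alike.

*Membership.* The set `E` is the `n`-th power of a self-similar subset of the line, whose `m`-th
stage has measure `2 ^ m = (R ^ m) ^ s` and which meets every interval of length `R ^ m` in a set of
measure at most `2 ^ (m + 1)` (`volume_lineStage_inter_Icc_le`). Hence `|E ∩ B| ≤ C |B| ^ s` for all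
balls `B` (`exists_volume_fractalSet_inter_ball_le`), which is the finiteness of the Morrey norm of
`f`. As `f` is bounded, it even lies in `V_0 𝓜^{p₀}_{q₀} ∩ V_0 𝓜^{p₁}_{q₁}`, and the intersection
lies in the interpolation space, through constant functions.

*Non-membership.* An element of `[X₀, X₁]_θ` is a sum `g₀ + g₁` with `g₀ ∈ X₀` and `g₁ ∈ X₁`, and `f`
is not even such a sum. For functions `g` in `V_∞`, the mean of `|g|` over the `m`-th stage `E_m` of
`E` is, by Jensen's inequality and `|E_m| ≈ |B(0, R ^ m)| ^ s`, at most a constant times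
`m(g, p, q; (n + 1) R ^ m)`, hence tends to `0` (`tendsto_laverage_fractalStage`). For `g` in `V^(*)`,
the mean of `|g|` over the balls inscribed in unit cubes of `E` that move to infinity tends to `0`
(`tendsto_laverage_cubeBall`). These properties pass to sums, but all these means are `1` for `f`.
-/

namespace VanishingMorrey

/-! ### The one-dimensional set -/

/-- The `m`-th stage of the one-dimensional set: the stage `m + 1` consists of two copies of the
stage `m`, placed at the two ends of the interval `[0, R ^ (m + 1)]`. -/
def lineStage (R : ℝ) : ℕ → Set ℝ
  | 0 => Icc 0 1
  | m + 1 => lineStage R m ∪ (fun t => t + -((R - 1) * R ^ m)) ⁻¹' lineStage R m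

lemma mem_lineStage_succ {R : ℝ} {m : ℕ} {t : ℝ} :
    t ∈ lineStage R (m + 1) ↔ t ∈ lineStage R m ∨ t - (R - 1) * R ^ m ∈ lineStage R m := by
  simp [lineStage, sub_eq_add_neg]

lemma measurableSet_lineStage (R : ℝ) (m : ℕ) : MeasurableSet (lineStage R m) := by
  induction m with
  | zero => exact measurableSet_Icc
  | succ m ih => exact ih.union ((measurable_id.add_const _) ih)

lemma monotone_lineStage (R : ℝ) : Monotone (lineStage R) :=
  monotone_nat_of_le_succ fun _ => subset_union_left

lemma lineStage_subset_Icc {R : ℝ} (hR : 2 < R) (m : ℕ) : lineStage R m ⊆ Icc 0 (R ^ m) := by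
  induction m with
  | zero => simp [lineStage]
  | succ m ih =>
    intro t ht
    have hpos : 0 < R ^ m := by positivity
    rw [pow_succ]
    rcases mem_lineStage_succ.1 ht with h | h <;> have h' := ih h <;>
      constructor <;> nlinarith [h'.1, h'.2]

/-- The finite sums of digits that describe the points of the `m`-th stage. -/
lemma mem_lineStage_iff {R : ℝ} {m : ℕ} {t : ℝ} :
    t ∈ lineStage R m ↔ ∃ A ⊆ Finset.range m, ∃ y ∈ Icc (0 : ℝ) 1,
      t = y + (R - 1) * ∑ j ∈ A, R ^ j := by
  induction m generalizing t with
  | zero => simp [lineStage]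
  | succ m ih =>
    rw [mem_lineStage_succ, ih, ih]
    constructor
    · rintro (⟨A, hA, y, hy, rfl⟩ | ⟨A, hA, y, hy, h⟩)
      · exact ⟨A, hA.trans (Finset.range_mono m.le_succ), y, hy, rfl⟩
      · have hm : m ∉ A := fun h => by simpa using hA h
        refine ⟨insert m A, ?_, y, hy, ?_⟩
        · rw [Finset.range_add_one]
          exact Finset.insert_subset_insert m hA
        · rw [Finset.sum_insert hm]
          linear_combination h
    · rintro ⟨A, hA, y, hy, rfl⟩
      by_cases hm : m ∈ A
      · refine Or.inr ⟨A.erase m, ?_, y, hy, ?_⟩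
        · rwa [Finset.range_add_one, Finset.subset_insert_iff] at hA
        · rw [← Finset.add_sum_erase A _ hm]
          ring
      · refine Or.inl ⟨A, fun j hj => ?_, y, hy, rfl⟩
        have := Finset.mem_range.1 (hA hj)
        have : j ≠ m := fun h => hm (h ▸ hj)
        exact Finset.mem_range.2 (by omega)

lemma volume_lineStage {R : ℝ} (hR : 2 < R) (m : ℕ) : volume (lineStage R m) = 2 ^ m := by
  induction m with
  | zero => simp [lineStage]
  | succ m ih =>
    have hpos : 0 < R ^ m := by positivity
    have hmeas : MeasurableSet ((fun t => t + -((R - 1) * R ^ m)) ⁻¹' lineStage R m) :=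
      (measurable_id.add_const _) (measurableSet_lineStage R m)
    rw [lineStage, measure_union ?_ hmeas, measure_preimage_add_right, ih, pow_succ, mul_two]
    refine Set.disjoint_left.2 fun t h h' => ?_
    have h1 := (lineStage_subset_Icc hR m h).2
    have h2 := (lineStage_subset_Icc hR m h').1
    nlinarith

/-- The second copy of the stage `N` contributes to `I` what the stage `N` contributes to a
translate of `I`. -/
lemma volume_lineStage_succ_inter_le (R : ℝ) (N : ℕ) (I : Set ℝ) :
    volume (lineStage R (N + 1) ∩ I) ≤ volume (lineStage R N ∩ I) +
      volume (lineStage R N ∩ (fun t => t + (R - 1) * R ^ N) ⁻¹' I) := by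
  rw [← measure_preimage_add_right volume (-((R - 1) * R ^ N))
    (lineStage R N ∩ (fun t => t + (R - 1) * R ^ N) ⁻¹' I)]
  refine (measure_mono ?_).trans (measure_union_le _ _)
  rintro t ⟨h | h, hI⟩
  · exact Or.inl ⟨h, hI⟩
  · exact Or.inr ⟨h, by simpa using hI⟩

lemma volume_lineStage_inter_Iic_le {R : ℝ} (hR : 2 < R) (m N : ℕ) :
    volume (lineStage R N ∩ Iic (R ^ m)) ≤ 2 ^ m := by
  rcases le_total N m with h | h
  · exact (measure_mono (inter_subset_left.trans (monotone_lineStage R h))).trans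
      (volume_lineStage hR m).le
  · induction N, h using Nat.le_induction with
    | base => exact (measure_mono inter_subset_left).trans (volume_lineStage hR m).le
    | succ N h ih =>
      refine (measure_mono ?_).trans ih
      rintro t ⟨ht, hI⟩
      refine ⟨(mem_lineStage_succ.1 ht).resolve_right fun h' => ?_, hI⟩
      have h1 := (lineStage_subset_Icc hR N h').1
      have h2 : R ^ m ≤ R ^ N := pow_le_pow_right₀ (by linarith) h
      have h3 : 0 < R ^ N := by positivity
      have h4 : t ≤ R ^ m := hI
      nlinarith

lemma volume_lineStage_inter_Ici_le {R : ℝ} (hR : 2 < R) {m N : ℕ} (h : m ≤ N) :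
    volume (lineStage R N ∩ Ici (R ^ N - R ^ m)) ≤ 2 ^ m := by
  induction N, h using Nat.le_induction with
  | base => exact (measure_mono inter_subset_left).trans (volume_lineStage hR m).le
  | succ N h ih =>
    have h2 : R ^ m ≤ R ^ N := pow_le_pow_right₀ (by linarith) h
    have h3 : 0 < R ^ N := by positivity
    have hempty : lineStage R N ∩ Ici (R ^ (N + 1) - R ^ m) = ∅ := by
      refine eq_empty_of_forall_notMem fun t ht => ?_
      have h1 := (lineStage_subset_Icc hR N ht.1).2
      have h4 : R ^ (N + 1) - R ^ m ≤ t := ht.2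
      rw [pow_succ] at h4
      nlinarith
    refine (volume_lineStage_succ_inter_le R N _).trans ?_
    rw [hempty, measure_empty, zero_add]
    refine (measure_mono (inter_subset_inter_right _ fun t ht => ?_)).trans ih
    have h4 : R ^ (N + 1) - R ^ m ≤ t + (R - 1) * R ^ N := ht
    rw [mem_Ici]
    rw [pow_succ] at h4
    linarith

/-- An interval of length `R ^ m` meets every stage in a set of measure at most `2 ^ (m + 1)`.
If it meets both copies of a stage, then, the gap between them having positive length, it meets
the first copy in its last part and the second copy in its first part. -/
lemma volume_lineStage_inter_Icc_le {R : ℝ} (hR : 2 < R) (m N : ℕ) (a : ℝ) :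
    volume (lineStage R N ∩ Icc a (a + R ^ m)) ≤ 2 ^ (m + 1) := by
  have hmm : (2 : ℝ≥0∞) ^ m ≤ 2 ^ (m + 1) := pow_le_pow_right₀ (by norm_num) m.le_succ
  rcases le_total N m with h | h
  · exact (measure_mono (inter_subset_left.trans (monotone_lineStage R h))).trans
      ((volume_lineStage hR m).le.trans hmm)
  · induction N, h using Nat.le_induction generalizing a with
    | base =>
      exact (measure_mono inter_subset_left).trans ((volume_lineStage hR m).le.trans hmm)
    | succ N h ih =>
      have h2 : R ^ m ≤ R ^ N := pow_le_pow_right₀ (by linarith) h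
      have h3 : 0 < R ^ N := by positivity
      have hsub := volume_lineStage_succ_inter_le R N (Icc a (a + R ^ m))
      by_cases hleft : a + R ^ m < (R - 1) * R ^ N
      · have hempty : lineStage R N ∩ (fun t => t + (R - 1) * R ^ N) ⁻¹' Icc a (a + R ^ m)
            = ∅ := by
          refine eq_empty_of_forall_notMem fun t ht => ?_
          have h1 := (lineStage_subset_Icc hR N ht.1).1
          have h4 : t + (R - 1) * R ^ N ≤ a + R ^ m := ht.2.2
          linarith
        rw [hempty, measure_empty, add_zero] at hsub
        exact hsub.trans (ih a)
      by_cases hright : R ^ N < a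
      · have hempty : lineStage R N ∩ Icc a (a + R ^ m) = ∅ := by
          refine eq_empty_of_forall_notMem fun t ht => ?_
          have h1 := (lineStage_subset_Icc hR N ht.1).2
          linarith [ht.2.1]
        rw [hempty, measure_empty, zero_add] at hsub
        refine hsub.trans ((measure_mono (inter_subset_inter_right _ fun t ht => ?_)).trans
          (ih (a - (R - 1) * R ^ N)))
        exact ⟨by linarith [ht.1], by linarith [ht.2]⟩
      push Not at hleft hright
      refine hsub.trans ?_
      rw [pow_succ, mul_two]
      refine add_le_add ?_ ?_
      · refine (measure_mono (inter_subset_inter_right _ fun t ht => ?_)).trans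
          (volume_lineStage_inter_Ici_le hR h)
        rw [mem_Ici]
        nlinarith [ht.1]
      · refine (measure_mono (inter_subset_inter_right _ fun t ht => ?_)).trans
          (volume_lineStage_inter_Iic_le hR m N)
        have h4 : t + (R - 1) * R ^ N ≤ a + R ^ m := ht.2
        rw [mem_Iic]
        nlinarith

lemma volume_iUnion_lineStage_inter_Icc_le {R : ℝ} (hR : 2 < R) (m : ℕ) (a : ℝ) :
    volume ((⋃ N, lineStage R N) ∩ Icc a (a + R ^ m)) ≤ 2 ^ (m + 1) := by
  rw [iUnion_inter, Monotone.measure_iUnion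
    fun _ _ h => inter_subset_inter_left _ (monotone_lineStage R h)]
  exact iSup_le fun N => volume_lineStage_inter_Icc_le hR m N a

/-! ### The set in `ℝⁿ` -/

lemma volume_setOf_forall_apply_mem {n : ℕ} {D : Fin n → Set ℝ} (hD : ∀ i, MeasurableSet (D i)) :
    volume {x : EuclideanSpace ℝ (Fin n) | ∀ i, x i ∈ D i} = ∏ i, volume (D i) := by
  rw [← volume_pi_pi, ← (PiLp.volume_preserving_ofLp (Fin n)).measure_preimage
    (MeasurableSet.univ_pi hD).nullMeasurableSet]
  congr 1
  ext x
  simp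

lemma fractalSet_eq (n : ℕ) (R : ℝ) :
    fractalSet n R = {x | ∀ i, x i ∈ ⋃ m, lineStage R m} := by
  ext x
  simp only [fractalSet, mem_ofPred_eq, mem_iUnion, mem_lineStage_iff]
  constructor
  · rintro ⟨A, y, hy, hx⟩ i
    obtain ⟨m, hm⟩ := (A i).exists_nat_subset_range
    exact ⟨m, A i, hm, y i, hy i, hx i⟩
  · intro h
    choose m A hA y hy hx using h
    exact ⟨A, y, hy, hx⟩

/-- The `m`-th stage of the fractal-type set, a union of `2 ^ (m n)` unit cubes. -/
def fractalStage (n : ℕ) (R : ℝ) (m : ℕ) : Set (EuclideanSpace ℝ (Fin n)) :=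
  {x | ∀ i, x i ∈ lineStage R m}

lemma fractalStage_subset (n : ℕ) (R : ℝ) (m : ℕ) : fractalStage n R m ⊆ fractalSet n R := by
  rw [fractalSet_eq]
  exact fun x hx i => mem_iUnion.2 ⟨m, hx i⟩

lemma volume_fractalStage {n : ℕ} {R : ℝ} (hR : 2 < R) (m : ℕ) :
    volume (fractalStage n R m) = (2 ^ m) ^ n := by
  rw [fractalStage, volume_setOf_forall_apply_mem fun _ => measurableSet_lineStage R m]
  simp [volume_lineStage hR]

lemma fractalStage_subset_ball {n : ℕ} {R : ℝ} (hR : 2 < R) (m : ℕ) :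
    fractalStage n R m ⊆ Metric.ball 0 ((n + 1) * R ^ m) := by
  intro x hx
  have hpos : 0 < R ^ m := by positivity
  rw [mem_ball_zero_iff, EuclideanSpace.norm_eq, Real.sqrt_lt' (by positivity)]
  have h : ∑ i, ‖x i‖ ^ 2 ≤ ∑ _i : Fin n, (R ^ m) ^ 2 := by
    refine Finset.sum_le_sum fun i _ => ?_
    have h1 := lineStage_subset_Icc hR m (hx i)
    rw [Real.norm_of_nonneg h1.1]
    exact pow_le_pow_left₀ h1.1 h1.2 2
  refine h.trans_lt ?_
  rw [Finset.sum_const, Finset.card_univ, Fintype.card_fin, nsmul_eq_mul, mul_pow]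
  have : (0 : ℝ) ≤ n := n.cast_nonneg
  exact mul_lt_mul_of_pos_right (by nlinarith) (by positivity)

lemma volume_ball_eq {n : ℕ} (x : EuclideanSpace ℝ (Fin n)) {r : ℝ} (hr : 0 < r) :
    volume (Metric.ball x r) =
      ENNReal.ofReal r ^ n * volume (Metric.ball (0 : EuclideanSpace ℝ (Fin n)) 1) := by
  rw [Measure.addHaar_ball_of_pos _ _ hr, finrank_euclideanSpace_fin, ENNReal.ofReal_pow hr.le]

lemma ofReal_pow_pow_rpow {R s : ℝ} (hs : ENNReal.ofReal R ^ s = 2) (m n : ℕ) :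
    ((ENNReal.ofReal R ^ m) ^ n) ^ s = (2 ^ m) ^ n := by
  rw [← pow_mul, ← pow_mul, ← hs, ← ENNReal.rpow_natCast, ← ENNReal.rpow_natCast,
    ← ENNReal.rpow_mul, ← ENNReal.rpow_mul, mul_comm]

/-- The stages have, up to a constant, the `s`-th power of the measure of the balls that contain
them, where `R ^ s = 2`. -/
lemma exists_volume_ball_rpow_le_fractalStage {n : ℕ} {R s : ℝ} (hR : 2 < R) (hs0 : 0 < s)
    (hs : ENNReal.ofReal R ^ s = 2) :
    ∃ C : ℝ≥0∞, C ≠ ∞ ∧ ∀ m : ℕ,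
      volume (Metric.ball (0 : EuclideanSpace ℝ (Fin n)) ((n + 1) * R ^ m)) ^ s
        ≤ C * volume (fractalStage n R m) := by
  set v := volume (Metric.ball (0 : EuclideanSpace ℝ (Fin n)) 1) with hv
  refine ⟨((ENNReal.ofReal (n + 1)) ^ n * v) ^ s, ?_, fun m => ?_⟩
  · exact ENNReal.rpow_ne_top_of_nonneg hs0.le
      (ENNReal.mul_ne_top (by simp) measure_ball_lt_top.ne)
  · rw [volume_ball_eq _ (by positivity), ← hv, ENNReal.ofReal_mul (by positivity),
      ENNReal.ofReal_pow (by positivity), volume_fractalStage hR, ← ofReal_pow_pow_rpow hs m n,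
      ← ENNReal.mul_rpow_of_nonneg _ _ hs0.le, mul_pow]
    exact le_of_eq (by ring_nf)

/-- The dimension estimate: the set has, up to a constant, at most measure `|B| ^ s` in each
ball `B`, where `R ^ s = 2`. -/
lemma exists_volume_fractalSet_inter_ball_le {n : ℕ} {R s : ℝ} (hR : 2 < R) (hs0 : 0 < s)
    (hs1 : s < 1) (hs : ENNReal.ofReal R ^ s = 2) :
    ∃ C : ℝ≥0∞, C ≠ ∞ ∧ ∀ (x : EuclideanSpace ℝ (Fin n)) (r : ℝ), 0 < r →
      volume (fractalSet n R ∩ Metric.ball x r) ≤ C * volume (Metric.ball x r) ^ s := by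
  set v := volume (Metric.ball (0 : EuclideanSpace ℝ (Fin n)) 1) with hv
  have hv0 : v ≠ 0 := (Metric.measure_ball_pos _ _ one_pos).ne'
  have hvt : v ≠ ∞ := measure_ball_lt_top.ne
  refine ⟨v ^ (1 - s) + (2 ^ 2) ^ n * (2 ^ n * v⁻¹) ^ s, ?_, fun x r hr => ?_⟩
  · refine ENNReal.add_ne_top.2 ⟨ENNReal.rpow_ne_top_of_nonneg (by linarith) hvt, ?_⟩
    exact ENNReal.mul_ne_top (by simp) (ENNReal.rpow_ne_top_of_nonneg hs0.le
      (ENNReal.mul_ne_top (by simp) (ENNReal.inv_ne_top.2 hv0)))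
  rw [add_mul]
  rcases lt_or_ge (2 * r) 1 with hr1 | hr1
  · -- In a ball of radius at most `1`, whose volume `V` is at most `v`, `V ≤ v ^ (1 - s) * V ^ s`.
    refine le_trans (measure_mono inter_subset_right) (le_trans ?_ le_self_add)
    have hV0 : volume (Metric.ball x r) ≠ 0 := (Metric.measure_ball_pos _ _ hr).ne'
    have hVt : volume (Metric.ball x r) ≠ ∞ := measure_ball_lt_top.ne
    calc volume (Metric.ball x r)
        = volume (Metric.ball x r) ^ (1 - s) * volume (Metric.ball x r) ^ s := by
          rw [← ENNReal.rpow_add _ _ hV0 hVt, sub_add_cancel, ENNReal.rpow_one]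
      _ ≤ v ^ (1 - s) * volume (Metric.ball x r) ^ s := by
          refine mul_le_mul_left (ENNReal.rpow_le_rpow ?_ (by linarith)) _
          rw [hv, ← Measure.addHaar_ball_center volume x 1]
          exact measure_mono (Metric.ball_subset_ball (by linarith))
  · refine le_trans ?_ le_add_self
    obtain ⟨k, hk, hk'⟩ := exists_nat_pow_near hr1 (by linarith : 1 < R)
    have hsub : fractalSet n R ∩ Metric.ball x r ⊆ {y | ∀ i, y i ∈
        (⋃ N, lineStage R N) ∩ Icc (x i - r) (x i - r + R ^ (k + 1))} := by
      rintro y ⟨hy, hyb⟩ i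
      rw [fractalSet_eq] at hy
      have h1 := (PiLp.norm_apply_le (y - x) i).trans_lt (mem_ball_iff_norm.1 hyb)
      rw [PiLp.sub_apply, Real.norm_eq_abs, abs_lt] at h1
      exact ⟨hy i, by linarith [h1.1], by linarith [h1.2]⟩
    refine (measure_mono hsub).trans ?_
    rw [volume_setOf_forall_apply_mem fun i =>
      (MeasurableSet.iUnion fun N => measurableSet_lineStage R N).inter measurableSet_Icc]
    calc ∏ i, volume ((⋃ N, lineStage R N) ∩ Icc (x i - r) (x i - r + R ^ (k + 1)))
        ≤ ∏ _i : Fin n, 2 ^ (k + 1 + 1) :=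
          Finset.prod_le_prod' fun i _ => volume_iUnion_lineStage_inter_Icc_le hR _ _
      _ = (2 ^ 2) ^ n * (2 ^ k) ^ n := by
          rw [Finset.prod_const, Finset.card_univ, Fintype.card_fin, ← mul_pow]
          ring
      _ = (2 ^ 2) ^ n * ((ENNReal.ofReal R ^ k) ^ n) ^ s := by rw [ofReal_pow_pow_rpow hs]
      _ ≤ (2 ^ 2) ^ n * (ENNReal.ofReal (2 * r) ^ n) ^ s := by
          rw [← ENNReal.ofReal_pow (by linarith)]
          gcongr
      _ = (2 ^ 2) ^ n * (2 ^ n * v⁻¹) ^ s * volume (Metric.ball x r) ^ s := by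
          rw [mul_assoc, ← ENNReal.mul_rpow_of_nonneg _ _ hs0.le, volume_ball_eq x hr, ← hv,
            ENNReal.ofReal_mul (by norm_num), mul_pow]
          congr 2
          rw [mul_assoc, mul_comm (v⁻¹), mul_assoc, ENNReal.mul_inv_cancel hv0 hvt, mul_one]
          simp

/-! ### Morrey norms of the indicator function -/

lemma enorm_fractalIndicator (n : ℕ) (R : ℝ) :
    (fun y => ‖fractalIndicator n R y‖ₑ) =ᵐ[volume] (fractalSet n R).indicator 1 := by
  filter_upwards [AEEqFun.coeFn_mk ((fractalSet n R).indicator fun _ => (1 : ℂ))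
    (stronglyMeasurable_const.indicator
      (measurableSet_fractalSet n R)).aestronglyMeasurable] with y hy
  rw [fractalIndicator, hy]
  by_cases h : y ∈ fractalSet n R <;> simp [h]

lemma lintegral_enorm_fractalIndicator_rpow {n : ℕ} {R q : ℝ} (hq : 0 < q)
    (S : Set (EuclideanSpace ℝ (Fin n))) :
    ∫⁻ y in S, ‖fractalIndicator n R y‖ₑ ^ q = volume (fractalSet n R ∩ S) := by
  rw [← Measure.restrict_apply (measurableSet_fractalSet n R),
    ← lintegral_indicator_one (measurableSet_fractalSet n R)]
  refine lintegral_congr_ae ?_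
  filter_upwards [ae_restrict_of_ae (enorm_fractalIndicator n R)] with y hy
  rw [hy]
  by_cases h : y ∈ fractalSet n R <;> simp [h, hq]

lemma laverage_enorm_fractalIndicator {n : ℕ} {R : ℝ} {S : Set (EuclideanSpace ℝ (Fin n))}
    (hS : S ⊆ fractalSet n R) (hS0 : volume S ≠ 0) (hSt : volume S ≠ ∞) :
    ⨍⁻ y in S, ‖fractalIndicator n R y‖ₑ ∂volume = 1 := by
  have h := lintegral_enorm_fractalIndicator_rpow (R := R) one_pos S
  simp only [ENNReal.rpow_one] at h
  rw [setLAverage_eq, h, inter_eq_self_of_subset_right hS, ENNReal.div_self hS0 hSt]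

lemma memMorrey_fractalIndicator {n : ℕ} {R p q : ℝ} (hq : 0 < q) (hqp : q < p) (hR : 2 < R)
    (hs : ENNReal.ofReal R ^ (1 - q / p) = 2) : MemMorrey p q (fractalIndicator n R) := by
  have hp : 0 < p := hq.trans hqp
  have hqp1 : q / p < 1 := (div_lt_one hp).2 hqp
  have hqp0 : 0 < q / p := div_pos hq hp
  obtain ⟨C, hC, h⟩ := exists_volume_fractalSet_inter_ball_le (n := n) hR (by linarith)
    (by linarith) hs
  refine lt_of_le_of_lt ?_ (ENNReal.rpow_lt_top_of_nonneg (one_div_nonneg.2 hq.le) hC)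
  refine iSup₂_le fun r hr => iSup_le fun x => ?_
  rw [lintegral_enorm_fractalIndicator_rpow hq]
  have hV0 : volume (Metric.ball x r) ≠ 0 := (Metric.measure_ball_pos _ _ hr).ne'
  have hVt : volume (Metric.ball x r) ≠ ∞ := measure_ball_lt_top.ne
  have hCx := h x r hr
  set V := volume (Metric.ball x r)
  calc V ^ (1 / p) * (V⁻¹ * volume (fractalSet n R ∩ Metric.ball x r)) ^ (1 / q)
      ≤ V ^ (1 / p) * (V⁻¹ * (C * V ^ (1 - q / p))) ^ (1 / q) := by gcongr
    _ = V ^ (1 / p) * (C * V ^ (-(q / p))) ^ (1 / q) := by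
        rw [mul_left_comm, ← ENNReal.rpow_neg_one, ← ENNReal.rpow_add _ _ hV0 hVt]
        ring_nf
    _ = C ^ (1 / q) * (V ^ (1 / p) * V ^ (-(1 / p))) := by
        rw [ENNReal.mul_rpow_of_nonneg _ _ (one_div_nonneg.2 hq.le), ← ENNReal.rpow_mul,
          mul_left_comm]
        congr 3
        field_simp
    _ = C ^ (1 / q) := by
        rw [← ENNReal.rpow_add _ _ hV0 hVt, add_neg_cancel, ENNReal.rpow_zero, mul_one]

/-- Being bounded by `1`, the indicator function satisfies `m(f, p, q; r) ≤ |B(0, r)| ^ (1 / p)`,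
which tends to `0` with `r`. -/
lemma memVZero_fractalIndicator {n : ℕ} (hn : 1 ≤ n) {R p q : ℝ} (hq : 0 < q) (hqp : q < p)
    (hR : 2 < R) (hs : ENNReal.ofReal R ^ (1 - q / p) = 2) :
    MemVZero p q (fractalIndicator n R) := by
  refine ⟨memMorrey_fractalIndicator hq hqp hR hs, ?_⟩
  have hp : 0 < p := hq.trans hqp
  set v := volume (Metric.ball (0 : EuclideanSpace ℝ (Fin n)) 1) with hv
  have hlim : Tendsto (fun r : ℝ => (ENNReal.ofReal r ^ n * v) ^ (1 / p)) (𝓝[>] 0) (𝓝 0) := by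
    have h1 : Tendsto (fun r : ℝ => ENNReal.ofReal r) (𝓝[>] 0) (𝓝 0) := by
      have := (ENNReal.continuous_ofReal.tendsto 0).mono_left
        (nhdsWithin_le_nhds (s := Ioi (0 : ℝ)))
      rwa [ENNReal.ofReal_zero] at this
    have h2 := ENNReal.Tendsto.mul_const (b := v) (ENNReal.Tendsto.pow (n := n) h1)
      (Or.inr measure_ball_lt_top.ne)
    have h3 := h2.ennrpow_const (1 / p)
    rwa [zero_pow (by omega), zero_mul, ENNReal.zero_rpow_of_pos (by positivity)] at h3
  refine tendsto_of_tendsto_of_tendsto_of_le_of_le' tendsto_const_nhds hlim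
    (Eventually.of_forall fun _ => zero_le) ?_
  filter_upwards [self_mem_nhdsWithin] with r hr
  refine iSup_le fun x => ?_
  have hVt : volume (Metric.ball x r) ≠ ∞ := measure_ball_lt_top.ne
  rw [lintegral_enorm_fractalIndicator_rpow hq, ← volume_ball_eq x hr]
  refine mul_le_of_le_one_right' (ENNReal.rpow_le_one ?_ (one_div_nonneg.2 hq.le))
  exact (mul_le_mul_right (measure_mono inter_subset_right) _).trans (ENNReal.inv_mul_le_one _)

/-! ### Averages of functions in the vanishing spaces -/

lemma laverage_enorm_le_rpow {n : ℕ} {q : ℝ} (hq : 1 ≤ q) (g : MeasFun n)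
    {S : Set (EuclideanSpace ℝ (Fin n))} (hS0 : volume S ≠ 0) (hSt : volume S ≠ ∞) :
    ⨍⁻ y in S, ‖g y‖ₑ ∂volume ≤ ((volume S)⁻¹ * ∫⁻ y in S, ‖g y‖ₑ ^ q) ^ (1 / q) := by
  have : IsProbabilityMeasure ((volume S)⁻¹ • volume.restrict S) :=
    ⟨by simp [ENNReal.inv_mul_cancel hS0 hSt]⟩
  have h := eLpNorm'_le_eLpNorm'_of_exponent_le one_pos hq ((volume S)⁻¹ • volume.restrict S)
    (g.aestronglyMeasurable.restrict.smul_measure _ : AEStronglyMeasurable g _)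
  simpa [eLpNorm'_eq_lintegral_enorm, setLAverage_eq, ENNReal.div_eq_inv_mul] using h

lemma laverage_enorm_le_morreyMod {n : ℕ} {p q r : ℝ} (hq : 1 ≤ q) (g : MeasFun n)
    {S : Set (EuclideanSpace ℝ (Fin n))} {x : EuclideanSpace ℝ (Fin n)} {C : ℝ≥0∞}
    (hr : 0 < r) (hS0 : volume S ≠ 0) (hS : S ⊆ Metric.ball x r)
    (hC : volume (Metric.ball x r) ^ (1 - q / p) ≤ C * volume S) :
    ⨍⁻ y in S, ‖g y‖ₑ ∂volume ≤ C ^ (1 / q) * morreyMod p q g r := by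
  have hq0 : 0 < q := by linarith
  have hV0 : volume (Metric.ball x r) ≠ 0 := (Metric.measure_ball_pos _ _ hr).ne'
  have hVt : volume (Metric.ball x r) ≠ ∞ := measure_ball_lt_top.ne
  have hSt : volume S ≠ ∞ := ((measure_mono hS).trans_lt measure_ball_lt_top).ne
  refine (laverage_enorm_le_rpow hq g hS0 hSt).trans ?_
  refine le_trans ?_ (mul_le_mul_right (le_iSup _ x) _)
  have hI : ∫⁻ y in S, ‖g y‖ₑ ^ q ≤ ∫⁻ y in Metric.ball x r, ‖g y‖ₑ ^ q :=
    lintegral_mono_set hS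
  set V := volume (Metric.ball x r)
  have hinv : (volume S)⁻¹ ≤ C * (V ^ (q / p) * V⁻¹) := by
    calc (volume S)⁻¹ = V ^ (1 - q / p) / volume S * (V ^ (q / p) * V⁻¹) := by
          rw [← ENNReal.rpow_neg_one V, ← ENNReal.rpow_add _ _ hV0 hVt, ENNReal.div_eq_inv_mul,
            mul_assoc, ← ENNReal.rpow_add _ _ hV0 hVt,
            show 1 - q / p + (q / p + -1) = 0 by ring, ENNReal.rpow_zero, mul_one]
      _ ≤ C * (V ^ (q / p) * V⁻¹) := by
          gcongr
          exact ENNReal.div_le_of_le_mul hC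
  calc ((volume S)⁻¹ * ∫⁻ y in S, ‖g y‖ₑ ^ q) ^ (1 / q)
      ≤ (C * (V ^ (q / p) * V⁻¹) * ∫⁻ y in Metric.ball x r, ‖g y‖ₑ ^ q) ^ (1 / q) := by
        gcongr
    _ = C ^ (1 / q) * (V ^ (1 / p) * (V⁻¹ * ∫⁻ y in Metric.ball x r, ‖g y‖ₑ ^ q) ^ (1 / q)) := by
        rw [mul_assoc, mul_assoc, ENNReal.mul_rpow_of_nonneg _ _ (one_div_nonneg.2 hq0.le),
          ENNReal.mul_rpow_of_nonneg _ _ (one_div_nonneg.2 hq0.le), ← ENNReal.rpow_mul]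
        congr 3
        field_simp

/-- The averages over the stages of the fractal-type set of a function in `V_∞` tend to `0`. -/
lemma tendsto_laverage_fractalStage {n : ℕ} {R p q : ℝ} (hq : 1 ≤ q) (hqp : q < p) (hR : 2 < R)
    (hs : ENNReal.ofReal R ^ (1 - q / p) = 2) {g : MeasFun n} (hg : MemVInfty p q g) :
    Tendsto (fun m => ⨍⁻ y in fractalStage n R m, ‖g y‖ₑ ∂volume) atTop (𝓝 0) := by
  have hp : 0 < p := by linarith
  have hqp1 : q / p < 1 := (div_lt_one hp).2 hqp
  obtain ⟨C, hC, h⟩ := exists_volume_ball_rpow_le_fractalStage (n := n) hR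
    (by linarith : 0 < 1 - q / p) hs
  have hrad : Tendsto (fun m : ℕ => ((n : ℝ) + 1) * R ^ m) atTop atTop :=
    (tendsto_pow_atTop_atTop_of_one_lt (by linarith)).const_mul_atTop (by positivity)
  have hlim := ENNReal.Tendsto.const_mul (a := C ^ (1 / q)) (hg.2.comp hrad)
    (Or.inr (ENNReal.rpow_ne_top_of_nonneg (by positivity) hC))
  rw [mul_zero] at hlim
  refine tendsto_of_tendsto_of_tendsto_of_le_of_le tendsto_const_nhds hlim
    (fun _ => zero_le) fun m => ?_
  exact laverage_enorm_le_morreyMod hq g (by positivity)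
    (by rw [volume_fractalStage hR]; positivity) (fractalStage_subset_ball hR m) (h m)

/-- The centre of the unit cube of the fractal-type set whose corner nearest to `0` has all its
coordinates equal to `(R - 1) * R ^ m`. -/
noncomputable def cubeCenter (n : ℕ) (R : ℝ) (m : ℕ) : EuclideanSpace ℝ (Fin n) :=
  WithLp.toLp 2 fun _ => (R - 1) * R ^ m + 1 / 2

/-- The ball inscribed in the unit cube of the fractal-type set whose corner nearest to `0` has
all its coordinates equal to `(R - 1) * R ^ m`. -/
def cubeBall (n : ℕ) (R : ℝ) (m : ℕ) : Set (EuclideanSpace ℝ (Fin n)) :=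
  Metric.ball (cubeCenter n R m) (1 / 2)

lemma abs_apply_sub_lt_of_mem_cubeBall {n : ℕ} {R : ℝ} {m : ℕ} {y : EuclideanSpace ℝ (Fin n)}
    (hy : y ∈ cubeBall n R m) (i : Fin n) : |y i - ((R - 1) * R ^ m + 1 / 2)| < 1 / 2 :=
  (PiLp.norm_apply_le (y - cubeCenter n R m) i).trans_lt (mem_ball_iff_norm.1 hy)

lemma cubeBall_subset (n : ℕ) (R : ℝ) (m : ℕ) : cubeBall n R m ⊆ fractalSet n R := by
  intro y hy
  refine ⟨fun _ => {m}, fun i => y i - (R - 1) * R ^ m, fun i => ?_, fun i => by simp⟩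
  have h := abs_lt.1 (abs_apply_sub_lt_of_mem_cubeBall hy i)
  exact ⟨by linarith [h.1], by linarith [h.2]⟩

lemma cubeBall_subset_compl {n : ℕ} (hn : 1 ≤ n) {R : ℝ} (hR : 2 < R) (m : ℕ) :
    cubeBall n R m ⊆ (Metric.ball 0 (m : ℝ))ᶜ := by
  intro y hy hy'
  have h := abs_lt.1 (abs_apply_sub_lt_of_mem_cubeBall hy ⟨0, hn⟩)
  have h1 := (PiLp.norm_apply_le y ⟨0, hn⟩).trans_lt (mem_ball_zero_iff.1 hy')
  rw [Real.norm_eq_abs, abs_lt] at h1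
  have h2 : (m : ℝ) < 2 ^ m := by exact_mod_cast m.lt_two_pow_self
  have h3 : (2 : ℝ) ^ m ≤ R ^ m := pow_le_pow_left₀ (by norm_num) hR.le m
  nlinarith [h.1, h1.2, (by positivity : 0 < R ^ m)]

lemma volume_cubeBall_ne_zero (n : ℕ) (R : ℝ) (m : ℕ) : volume (cubeBall n R m) ≠ 0 :=
  (Metric.measure_ball_pos _ _ (by norm_num)).ne'

lemma volume_cubeBall_ne_top (n : ℕ) (R : ℝ) (m : ℕ) : volume (cubeBall n R m) ≠ ∞ :=
  measure_ball_lt_top.ne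

/-- The averages of a function in `V^(*)` over the balls inscribed in unit cubes that move to
infinity tend to `0`. -/
lemma tendsto_laverage_cubeBall {n : ℕ} (hn : 1 ≤ n) {R p q : ℝ} (hq : 1 ≤ q) (hR : 2 < R)
    {g : MeasFun n} (hg : MemVStar p q g) :
    Tendsto (fun m => ⨍⁻ y in cubeBall n R m, ‖g y‖ₑ ∂volume) atTop (𝓝 0) := by
  have hq0 : 0 < q := by linarith
  set v := volume (Metric.ball (0 : EuclideanSpace ℝ (Fin n)) (1 / 2))
  have hv : v ≠ 0 := (Metric.measure_ball_pos _ _ (by norm_num)).ne'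
  have hlim := (ENNReal.Tendsto.const_mul (a := v⁻¹) hg.2
    (Or.inr (ENNReal.inv_ne_top.2 hv))).ennrpow_const (1 / q)
  rw [mul_zero, ENNReal.zero_rpow_of_pos (by positivity)] at hlim
  refine tendsto_of_tendsto_of_tendsto_of_le_of_le tendsto_const_nhds hlim
    (fun _ => zero_le) fun m => ?_
  refine (laverage_enorm_le_rpow hq g (volume_cubeBall_ne_zero n R m)
    (volume_cubeBall_ne_top n R m)).trans ?_
  rw [show volume (cubeBall n R m) = v from Measure.addHaar_ball_center _ _ _]
  refine ENNReal.rpow_le_rpow (mul_le_mul_right ?_ _) (by positivity)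
  refine le_trans ?_ (le_iSup _ (cubeCenter n R m))
  rw [lintegral_indicator Metric.isOpen_ball.measurableSet.compl,
    Measure.restrict_restrict Metric.isOpen_ball.measurableSet.compl]
  exact lintegral_mono_set (subset_inter (cubeBall_subset_compl hn hR m)
    (Metric.ball_subset_ball (by norm_num)))

lemma tendsto_laverage_enorm_add {n : ℕ} {g h : MeasFun n}
    {S : ℕ → Set (EuclideanSpace ℝ (Fin n))}
    (hg : Tendsto (fun m => ⨍⁻ y in S m, ‖g y‖ₑ ∂volume) atTop (𝓝 0))
    (hh : Tendsto (fun m => ⨍⁻ y in S m, ‖h y‖ₑ ∂volume) atTop (𝓝 0)) :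
    Tendsto (fun m => ⨍⁻ y in S m, ‖(g + h) y‖ₑ ∂volume) atTop (𝓝 0) := by
  refine tendsto_of_tendsto_of_tendsto_of_le_of_le tendsto_const_nhds
    (by simpa using hg.add hh) (fun _ => zero_le) fun m => ?_
  simp only [setLAverage_eq]
  rw [← ENNReal.add_div, ← lintegral_add_left' g.aestronglyMeasurable.enorm.restrict]
  gcongr ?_ / _
  refine lintegral_mono_ae ?_
  filter_upwards [ae_restrict_of_ae (AEEqFun.coeFn_add g h)] with y hy
  rw [hy]
  exact enorm_add_le _ _

lemma not_tendsto_laverage_fractalIndicator {n : ℕ} {R : ℝ}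
    {S : ℕ → Set (EuclideanSpace ℝ (Fin n))} (hS : ∀ m, S m ⊆ fractalSet n R)
    (hS0 : ∀ m, volume (S m) ≠ 0) (hSt : ∀ m, volume (S m) ≠ ∞) :
    ¬ Tendsto (fun m => ⨍⁻ y in S m, ‖fractalIndicator n R y‖ₑ ∂volume) atTop (𝓝 0) := by
  intro h
  simp only [fun m => laverage_enorm_fractalIndicator (hS m) (hS0 m) (hSt m)] at h
  exact one_ne_zero (tendsto_nhds_unique tendsto_const_nhds h)

lemma not_tendsto_laverage_fractalStage {n : ℕ} {R : ℝ} (hR : 2 < R) :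
    ¬ Tendsto (fun m => ⨍⁻ y in fractalStage n R m, ‖fractalIndicator n R y‖ₑ ∂volume) atTop (𝓝 0) :=
  not_tendsto_laverage_fractalIndicator (fractalStage_subset n R)
    (fun m => by rw [volume_fractalStage hR]; positivity)
    (fun m => by rw [volume_fractalStage hR]; simp)

lemma not_tendsto_laverage_cubeBall (n : ℕ) (R : ℝ) :
    ¬ Tendsto (fun m => ⨍⁻ y in cubeBall n R m, ‖fractalIndicator n R y‖ₑ ∂volume) atTop (𝓝 0) :=
  not_tendsto_laverage_fractalIndicator (cubeBall_subset n R) (volume_cubeBall_ne_zero n R)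
    (volume_cubeBall_ne_top n R)

/-! ### Interpolation spaces, intersections and sums -/

section Interpolation

variable {Z X₀ X₁ : Type*} [AddCommGroup Z] [Module ℂ Z]
  [NormedAddCommGroup X₀] [NormedSpace ℂ X₀] [NormedAddCommGroup X₁] [NormedSpace ℂ X₁]

/-- The intersection of `X₀` and `X₁` lies in `[X₀, X₁]_θ`, through constant functions. -/
lemma mem_complexInterpolation_of_eq {ι₀ : X₀ →ₗ[ℂ] Z} {ι₁ : X₁ →ₗ[ℂ] Z} (θ : ℝ) {f : Z}
    {x₀ : X₀} {x₁ : X₁} (h₀ : ι₀ x₀ = f) (h₁ : ι₁ x₁ = f) :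
    f ∈ complexInterpolation ι₀ ι₁ θ := by
  have hx : SumSpace.inl ι₀ ι₁ x₀ = SumSpace.inr ι₀ ι₁ x₁ := by
    refine (Submodule.Quotient.eq _).2 ?_
    simp [h₀, h₁]
  refine ⟨fun _ => SumSpace.inl ι₀ ι₁ x₀, ⟨continuousOn_const, ⟨_, fun _ _ => le_rfl⟩,
    differentiableOn_const _, ⟨fun _ => x₀, continuous_const, ⟨_, fun _ => le_rfl⟩, fun _ => rfl⟩,
    ⟨fun _ => x₁, continuous_const, ⟨_, fun _ => le_rfl⟩, fun _ => hx⟩⟩, ?_⟩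
  simp [SumSpace.inl, SumSpace.incl, h₀]

lemma exists_add_eq_of_mem_complexInterpolation {ι₀ : X₀ →ₗ[ℂ] Z} {ι₁ : X₁ →ₗ[ℂ] Z} {θ : ℝ}
    {f : Z} (hf : f ∈ complexInterpolation ι₀ ι₁ θ) : ∃ x₀ x₁, ι₀ x₀ + ι₁ x₁ = f := by
  obtain ⟨F, -, rfl⟩ := hf
  obtain ⟨⟨x₀, x₁⟩, hx⟩ := Submodule.Quotient.mk_surjective _ (F θ)
  exact ⟨x₀, x₁, by rw [← hx]; simp [SumSpace.incl]⟩

end Interpolation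

lemma exists_subIncl_vZero_eq {n : ℕ} {p q : ℝ} (hq : 1 ≤ q) {f : MeasFun n}
    (hf : MemVZero p q f) : ∃ x : VZero n p q hq, subIncl _ x = f :=
  ⟨⟨⟨f, hf.1⟩, hf⟩, rfl⟩

lemma memVStar_subIncl {n : ℕ} {p q : ℝ} {hq : 1 ≤ q} (g : VStar n p q hq) :
    MemVStar p q (subIncl _ g) := g.2

lemma memVInfty_subIncl {n : ℕ} {p q : ℝ} {hq : 1 ≤ q} (g : VInfty n p q hq) :
    MemVInfty p q (subIncl _ g) := g.2

/-! ### The exponents -/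

/-- The equation for `R` depends on `p` and `q` only through `q / p`. -/
lemma ofReal_rpow_eq_two {n : ℕ} (hn : 1 ≤ n) {R p q : ℝ} (hq : 0 < q) (hR : 2 < R)
    (h : R ^ ((n : ℝ) / p - (n : ℝ) / q) * (2 : ℝ) ^ ((n : ℝ) / q) = 1) :
    ENNReal.ofReal R ^ (1 - q / p) = 2 := by
  have hR0 : 0 < R := by linarith
  have hn0 : (0 : ℝ) < n := by exact_mod_cast hn
  have key : R ^ (1 - q / p) = 2 := by
    have h1 : (R ^ ((n : ℝ) / p - n / q) * (2 : ℝ) ^ ((n : ℝ) / q)) ^ (q / n) = 1 := by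
      rw [h, Real.one_rpow]
    rw [Real.mul_rpow (by positivity) (by positivity), ← Real.rpow_mul hR0.le,
      ← Real.rpow_mul (by norm_num), show ((n : ℝ) / p - n / q) * (q / n) = -(1 - q / p) by
        field_simp; ring, show (n : ℝ) / q * (q / n) = 1 by field_simp, Real.rpow_one,
      Real.rpow_neg hR0.le] at h1
    have h2 : 0 < R ^ (1 - q / p) := by positivity
    field_simp at h1
    exact h1.symm
  rw [ENNReal.ofReal_rpow_of_pos hR0, key]
  simp

end VanishingMorrey

open VanishingMorrey in
theorem corollary6p1 (n : ℕ) (hn : 1 ≤ n) (θ p₀ q₀ p₁ q₁ p q R : ℝ)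
    (hθ : 0 < θ) (hθ' : θ < 1)
    (hq₀ : 1 ≤ q₀) (hqp₀ : q₀ < p₀) (hq₁ : 1 ≤ q₁) (hqp₁ : q₁ < p₁)
    (hratio : p₀ / q₀ = p₁ / q₁)
    (hp : 1 / p = (1 - θ) / p₀ + θ / p₁)
    (hq : 1 / q = (1 - θ) / q₀ + θ / q₁)
    (hR : 2 < R)
    (hReq : R ^ ((n : ℝ) / p - (n : ℝ) / q) * (2 : ℝ) ^ ((n : ℝ) / q) = 1) :
    fractalIndicator n R ∈
        morreyInterpolation (VZero n p₀ q₀ hq₀) (VZero n p₁ q₁ hq₁) θ ∧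
      fractalIndicator n R ∉
        morreyInterpolation (VStar n p₀ q₀ hq₀) (VStar n p₁ q₁ hq₁) θ ∪
          morreyInterpolation (VInfty n p₀ q₀ hq₀) (VInfty n p₁ q₁ hq₁) θ ∧
      MemMorrey p q (fractalIndicator n R) ∧
      ¬ MemVStar p q (fractalIndicator n R) ∧
      ¬ MemVInfty p q (fractalIndicator n R) := by
  have hq₀' : 0 < q₀ := by linarith
  have hq₁' : 0 < q₁ := by linarith
  have hp₀' : 0 < p₀ := by linarith
  have hp₁' : 0 < p₁ := by linarith
  have hθ1 : 0 < 1 - θ := by linarith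
  have hqinv : 0 < 1 / q := hq ▸ by positivity
  have hq' : 0 < q := one_div_pos.1 hqinv
  have hpinv : 0 < 1 / p := hp ▸ by positivity
  have hp' : 0 < p := one_div_pos.1 hpinv
  have hq1 : 1 ≤ q := by
    have h0 : (1 - θ) / q₀ ≤ 1 - θ := div_le_self hθ1.le hq₀
    have h1 : θ / q₁ ≤ θ := div_le_self hθ.le hq₁
    exact (one_div_le_one_div hq' one_pos).1 (by rw [hq]; linarith)
  -- The three pairs of exponents have the same quotient.
  have hr₁ : q₁ / p₁ = q₀ / p₀ := by
    rw [← inv_div, ← hratio, inv_div]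
  have hr : q / p = q₀ / p₀ := by
    have h0 : (1 - θ) / p₀ = q₀ / p₀ * ((1 - θ) / q₀) := by field_simp
    have h1 : θ / p₁ = q₀ / p₀ * (θ / q₁) := by rw [← hr₁]; field_simp
    rw [div_eq_mul_one_div q p, hp, h0, h1, ← mul_add, ← hq]
    field_simp
  have hqp : q < p := by
    rw [← div_lt_one hp', hr]
    exact (div_lt_one hp₀').2 hqp₀
  have hs := ofReal_rpow_eq_two hn hq' hR hReq
  have hs₀ : ENNReal.ofReal R ^ (1 - q₀ / p₀) = 2 := by rw [← hr, hs]
  have hs₁ : ENNReal.ofReal R ^ (1 - q₁ / p₁) = 2 := by rw [hr₁, hs₀]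
  have h₀ := memVZero_fractalIndicator hn hq₀' hqp₀ hR hs₀
  have h₁ := memVZero_fractalIndicator hn hq₁' hqp₁ hR hs₁
  refine ⟨?_, ?_, memMorrey_fractalIndicator hq' hqp hR hs, fun h => ?_, fun h => ?_⟩
  · obtain ⟨x₀, hx₀⟩ := exists_subIncl_vZero_eq hq₀ h₀
    obtain ⟨x₁, hx₁⟩ := exists_subIncl_vZero_eq hq₁ h₁
    exact mem_complexInterpolation_of_eq θ hx₀ hx₁
  · rintro (h | h) <;> obtain ⟨g₀, g₁, hg⟩ := exists_add_eq_of_mem_complexInterpolation h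
    · refine not_tendsto_laverage_cubeBall n R ?_
      rw [← hg]
      exact tendsto_laverage_enorm_add (tendsto_laverage_cubeBall hn hq₀ hR (memVStar_subIncl g₀))
        (tendsto_laverage_cubeBall hn hq₁ hR (memVStar_subIncl g₁))
    · refine not_tendsto_laverage_fractalStage (n := n) hR ?_
      rw [← hg]
      exact tendsto_laverage_enorm_add
        (tendsto_laverage_fractalStage hq₀ hqp₀ hR hs₀ (memVInfty_subIncl g₀))
        (tendsto_laverage_fractalStage hq₁ hqp₁ hR hs₁ (memVInfty_subIncl g₁))
  · exact not_tendsto_laverage_cubeBall n R (tendsto_laverage_cubeBall hn hq1 hR h)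
  · exact not_tendsto_laverage_fractalStage hR (tendsto_laverage_fractalStage hq1 hqp hR hs h)
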